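/- For $n\in\{6,7,8\}$ let $A(E_n)$ be the Artin group of type $E_n$, and let $\Delta$ be one of Carter's diagrams $E_6(a_i)$ ($i=1,2$), $E_7(a_i)$ ($1\le i\le 4$), $E_8(a_i)$ ($1\le i\le 8$), a graph on $n$ vertices. Explicitly, on the vertex set $\{0,\dots,n-1\}$, let $L$ be the graph on $\{0,\dots,5\}$ with edges $01,12,34,45,03,14$ and let $L'$ be $L$ with the further edge $25$. Then the edges of the diagrams are: - $E_6(a_1)$: $L$; $E_6(a_2)$: $L'$; - $E_7(a_1)$: $L$ and $56$; $E_7(a_2)$: $L$ and $36$; $E_7(a_3)$: $L'$ and $56$; $E_7(a_4)$: $L'$ and $56,36$; - $E_8(a_1)$: $L$ and $56,67$; $E_8(a_2)$: $L$ and $56,07$; $E_8(a_3)$: $L$ and $36,07$; $E_8(a_4)$: $L'$ and $56,67$; $E_8(a_5)$: $L'$ and $56,07$; $E_8(a_6)$: $L'$ and $56,67,27$; $E_8(a_7)$: $L'$ and $56,36,67$; $E_8(a_8)$: the edge graph of a cube. Suppose that $\Delta$ is orientable, that is, its edges can be oriented in such a way that each $4$-cycle of $\Delta$ becomes a directed cycle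 (this excludes exactly $E_7(a_4)$, $E_8(a_7)$ and $E_8(a_8)$), and fix any such orientation. **Theorem.** The Artin group $A(E_n)$ admits a presentation whose generators correspond to the vertices of $\Delta$, with the following relations: 1. for each pair of vertices $s,t$ of $\Delta$, the relation $sts=tst$ if $s$ and $t$ are joined by an edge, and $st=ts$ if they are not; 2. for each oriented $4$-cycle $s_1\to s_2\to s_3\to s_4\to s_1$ of $\Delta$, one cycle commutator relator $[s_1,\,s_2s_3s_4s_3^{-1}s_2^{-1}]$, where any of the four vertices of the cycle may be chosen as $s_1$. -/

import Mathlib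

namespace CarterArtin

/-! ### Artin groups -/

/-- The Artin relators of a Coxeter matrix `M`: for all `i`, `j`, the relator expressing that the
two alternating words `… i j` and `… j i` of length `M i j` are equal. (The entry `M i j = 0` encodes
`m = ∞`; then both words are empty and there is no relation.) -/
def artinRelators {B : Type*} (M : CoxeterMatrix B) : Set (FreeGroup B) :=
  {r | ∃ i j : B,
    r = ((CoxeterSystem.alternatingWord i j (M i j)).map FreeGroup.of).prod *
        ((CoxeterSystem.alternatingWord j i (M i j)).map FreeGroup.of).prod⁻¹}

/-- The Artin group `A(M)` of a Coxeter matrix `M`. -/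
abbrev ArtinGroup {B : Type*} (M : CoxeterMatrix B) : Type _ :=
  PresentedGroup (artinRelators M)

/-- The types `E₆`, `E₇`, `E₈`. -/
inductive EType
  | E6
  | E7
  | E8

/-- The rank of the type `E_n`, that is, `n`. -/
def EType.rank : EType → ℕ
  | .E6 => 6
  | .E7 => 7
  | .E8 => 8

/-- The Coxeter matrix of type `E_n`. -/
def EType.coxeterMatrix : (t : EType) → CoxeterMatrix (Fin t.rank)
  | .E6 => CoxeterMatrix.E₆
  | .E7 => CoxeterMatrix.E₇
  | .E8 => CoxeterMatrix.E₈

/-! ### The Carter diagrams `E_n(a_i)` -/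

/-- The names of Carter's diagrams `E₆(a_i)`, `E₇(a_i)`, `E₈(a_i)` of the proper quasi-Coxeter
elements. -/
inductive CarterDiagram : EType → Type
  | E6a1 : CarterDiagram .E6
  | E6a2 : CarterDiagram .E6
  | E7a1 : CarterDiagram .E7
  | E7a2 : CarterDiagram .E7
  | E7a3 : CarterDiagram .E7
  | E7a4 : CarterDiagram .E7
  | E8a1 : CarterDiagram .E8
  | E8a2 : CarterDiagram .E8
  | E8a3 : CarterDiagram .E8
  | E8a4 : CarterDiagram .E8
  | E8a5 : CarterDiagram .E8
  | E8a6 : CarterDiagram .E8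
  | E8a7 : CarterDiagram .E8
  | E8a8 : CarterDiagram .E8

/-- The edges of the Carter diagrams. In all of them except `E₈(a₈)`, the vertices `0, …, 5` are
placed as
```
    3 --- 4 --- 5
    |     |     :
    0 --- 1 --- 2
```
where the edge `{2, 5}` is present in some diagrams only, and the vertices `6` and `7` are attached
to these. The diagram `E₈(a₈)` is the graph of a cube. -/
def CarterDiagram.edges : {t : EType} → CarterDiagram t → List (ℕ × ℕ)
  | _, .E6a1 => [(0, 1), (1, 2), (3, 4), (4, 5), (0, 3), (1, 4)]
  | _, .E6a2 => [(0, 1), (1, 2), (3, 4), (4, 5), (0, 3), (1, 4), (2, 5)]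
  | _, .E7a1 => [(0, 1), (1, 2), (3, 4), (4, 5), (0, 3), (1, 4), (5, 6)]
  | _, .E7a2 => [(0, 1), (1, 2), (3, 4), (4, 5), (0, 3), (1, 4), (3, 6)]
  | _, .E7a3 => [(0, 1), (1, 2), (3, 4), (4, 5), (0, 3), (1, 4), (2, 5), (5, 6)]
  | _, .E7a4 => [(0, 1), (1, 2), (3, 4), (4, 5), (0, 3), (1, 4), (2, 5), (5, 6), (3, 6)]
  | _, .E8a1 => [(0, 1), (1, 2), (3, 4), (4, 5), (0, 3), (1, 4), (5, 6), (6, 7)]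
  | _, .E8a2 => [(0, 1), (1, 2), (3, 4), (4, 5), (0, 3), (1, 4), (5, 6), (0, 7)]
  | _, .E8a3 => [(0, 1), (1, 2), (3, 4), (4, 5), (0, 3), (1, 4), (3, 6), (0, 7)]
  | _, .E8a4 => [(0, 1), (1, 2), (3, 4), (4, 5), (0, 3), (1, 4), (2, 5), (5, 6), (6, 7)]
  | _, .E8a5 => [(0, 1), (1, 2), (3, 4), (4, 5), (0, 3), (1, 4), (2, 5), (5, 6), (0, 7)]
  | _, .E8a6 => [(0, 1), (1, 2), (3, 4), (4, 5), (0, 3), (1, 4), (2, 5), (5, 6), (6, 7), (2, 7)]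
  | _, .E8a7 => [(0, 1), (1, 2), (3, 4), (4, 5), (0, 3), (1, 4), (2, 5), (5, 6), (3, 6), (6, 7)]
  | _, .E8a8 => [(0, 1), (0, 4), (0, 2), (1, 5), (1, 3), (2, 6), (2, 3), (3, 7), (4, 5), (4, 6),
      (6, 7), (5, 7)]

/-- The Carter diagram as a simple graph on `n` vertices. -/
def CarterDiagram.graph {t : EType} (Δ : CarterDiagram t) : SimpleGraph (Fin t.rank) :=
  SimpleGraph.fromRel fun i j => (i.val, j.val) ∈ Δ.edges

/-! ### Orientations and oriented 4-cycles -/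

section Orientation

variable {V : Type*}

/-- `c` runs through the vertices of a 4-cycle `c 0 — c 1 — c 2 — c 3 — c 0` of the graph `G`
(indices modulo 4). -/
def IsFourCycle (G : SimpleGraph V) (c : Fin 4 → V) : Prop :=
  Function.Injective c ∧ ∀ i, G.Adj (c i) (c (i + 1))

/-- `c` runs through the vertices of an oriented 4-cycle `c 0 → c 1 → c 2 → c 3 → c 0` of the
directed graph `D` (indices modulo 4). -/
def IsOrientedFourCycle (D : Digraph V) (c : Fin 4 → V) : Prop :=
  Function.Injective c ∧ ∀ i, D.Adj (c i) (c (i + 1))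

/-- `D` is obtained from `G` by giving each edge exactly one of its two directions, in such a way
that each 4-cycle of `G` is oriented, that is, a directed cycle in one of its two senses. -/
structure IsCycleOrientation (G : SimpleGraph V) (D : Digraph V) : Prop where
  adj_iff : ∀ u v, G.Adj u v ↔ D.Adj u v ∨ D.Adj v u
  asymm : ∀ u v, D.Adj u v → ¬ D.Adj v u
  oriented : ∀ c, IsFourCycle G c →
    (∀ i, D.Adj (c i) (c (i + 1))) ∨ (∀ i, D.Adj (c (i + 1)) (c i))

/-- `C` consists of one tuple `(s₁, s₂, s₃, s₄)` with `s₁ → s₂ → s₃ → s₄ → s₁` for each oriented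
4-cycle of `D`: of the four tuples that describe a given oriented 4-cycle, and that differ by a
rotation, exactly one lies in `C`. -/
structure IsCycleTransversal (D : Digraph V) (C : Set (Fin 4 → V)) : Prop where
  isOriented : ∀ c ∈ C, IsOrientedFourCycle D c
  existsUnique : ∀ c, IsOrientedFourCycle D c → ∃! k : Fin 4, (fun i => c (i + k)) ∈ C

end Orientation

/-! ### The relators -/

section Relators

variable {V : Type*}

open FreeGroup (of)
open scoped commutatorElement

/-- The relations `R(G)`: `s t s = t s t` if `s` and `t` are joined by an edge and `s t = t s` if
they are not. -/
def braidRelators (G : SimpleGraph V) : Set (FreeGroup V) :=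
  {r | ∃ s t : V, G.Adj s t ∧ r = of s * of t * of s * (of t * of s * of t)⁻¹} ∪
  {r | ∃ s t : V, ¬ G.Adj s t ∧ r = of s * of t * (of t * of s)⁻¹}

/-- The cycle commutator `[s₁, s₂ s₃ s₄ s₃⁻¹ s₂⁻¹]` of the tuple `c = (s₁, s₂, s₃, s₄)`. -/
def cycleCommutator (c : Fin 4 → V) : FreeGroup V :=
  ⁅of (c 0), of (c 1) * of (c 2) * of (c 3) * (of (c 2))⁻¹ * (of (c 1))⁻¹⁆

/-- The group generated by the vertices of `G` with the relations `R(G)` and the cycle commutators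
of the tuples in `C`. -/
abbrev DiagramGroup (G : SimpleGraph V) (C : Set (Fin 4 → V)) : Type _ :=
  PresentedGroup (braidRelators G ∪ cycleCommutator '' C)

end Relators

end CarterArtin

/-!
The proof deforms a diagram into the Coxeter diagram of type `E_n` by quiver mutations.

A quiver with a list of oriented cycles of length 3 or 4 defines a group (`CycleQuiver.relators`):
braid and commutation relations for its underlying graph, and for each listed cycle
`s₁ → ⋯ → sₘ → s₁` the relation that `s₁` commutes with the conjugate of `sₘ` by `s₂ ⋯ sₘ₋₁`. Modulo
the braid relations, the vertex at which a cycle starts does not matter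
(`CycleQuiver.IsChordless.cycleRel_of_isRotated`), and inverting all generators yields the relations
of the opposite quiver (`CycleQuiver.Holds.op`). Hence the group of an orientable diagram depends
neither on the chosen cycle commutators nor on the orientation: each of the diagrams in question has
only two orientations of its 4-cycles, opposite to each other
(`CycleQuiver.nonempty_mulEquiv_diagramGroup`).

Mutation at a vertex `k` replaces the generator `sᵢ` by `s_k⁻¹ sᵢ s_k` for each arrow `i → k`. The new
generators satisfy the relations of the mutated quiver (`CycleQuiver.IsMutation.holds`): a path
`i → k → j` gives the braid relation of a new arrow `i → j`, while the relation of a triangle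
`i → k → j → i` becomes the commutation of the new generators at `i` and `j`; and a 4-cycle through
`k` and a triangle are exchanged in the same way. The inverse substitution is the same construction
for the opposite quivers, so a mutation does not change the group
(`CycleQuiver.IsMutation.nonempty_mulEquiv`). The conditions that this argument puts on a quiver and
its mutation are decidable (`CycleQuiver.IsMutation`).

Every orientable diagram becomes, after at most seven mutations that involve no chordless cycles
longer than 4, a tree of type `E_n`, whose group is the Artin group
(`CycleQuiver.IsCoxeterTree.nonempty_mulEquiv`). The other three diagrams have a vertex with three
neighbours any two of which lie in a common 4-cycle through it, which excludes an orientation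
(`IsCycleOrientation.false_of_three_cycles`).
-/

namespace CarterArtin

/-! ### Presented groups and conjugation identities -/

section Group

variable {G : Type*} [Group G]

/-- Two families of generators that express each other give an isomorphism of presented groups. -/
theorem nonempty_mulEquiv_of_generators {V W : Type*} {R : Set (FreeGroup V)}
    {S : Set (FreeGroup W)} (x : V → PresentedGroup S) (y : W → PresentedGroup R)
    (hx : ∀ r ∈ R, FreeGroup.lift x r = 1) (hy : ∀ r ∈ S, FreeGroup.lift y r = 1)
    (hxy : ∀ w, PresentedGroup.toGroup hx (y w) = PresentedGroup.of w)
    (hyx : ∀ v, PresentedGroup.toGroup hy (x v) = PresentedGroup.of v) :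
    Nonempty (PresentedGroup R ≃* PresentedGroup S) := by
  refine ⟨MonoidHom.toMulEquiv (PresentedGroup.toGroup hx) (PresentedGroup.toGroup hy) ?_ ?_⟩
  · ext v
    simpa using hyx v
  · ext w
    simpa using hxy w

theorem lift_of_eq_one {V : Type*} {R : Set (FreeGroup V)} {r : FreeGroup V} (hr : r ∈ R) :
    FreeGroup.lift (PresentedGroup.of : V → PresentedGroup R) r = 1 := by
  have : FreeGroup.lift (PresentedGroup.of : V → PresentedGroup R) = PresentedGroup.mk R := by
    ext v; simp [PresentedGroup.of]
  rw [this, PresentedGroup.one_of_mem hr]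

/-- The braid relation `x y x = y x y`. -/
def Braided (x y : G) : Prop := x * y * x = y * x * y

theorem Braided.symm {x y : G} (h : Braided x y) : Braided y x := Eq.symm h

theorem Braided.inv_conj_eq {x y : G} (h : Braided x y) : y⁻¹ * x * y = x * y * x⁻¹ := by
  rw [eq_mul_inv_iff_mul_eq, mul_assoc, mul_assoc, inv_mul_eq_iff_eq_mul, ← mul_assoc, h, mul_assoc]

theorem Braided.conj {x y : G} (h : Braided x y) (g : G) :
    Braided (g⁻¹ * x * g) (g⁻¹ * y * g) := by
  have h' : x * y * x = y * x * y := h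
  calc g⁻¹ * x * g * (g⁻¹ * y * g) * (g⁻¹ * x * g) = g⁻¹ * (x * y * x) * g := by group
    _ = _ := by rw [h']; group

theorem Braided.inv {x y : G} (h : Braided x y) : Braided x⁻¹ y⁻¹ := by
  have h' : x * y * x = y * x * y := h
  have := congrArg (·⁻¹) h'
  simpa [Braided, mul_assoc] using this

theorem commute_conj_iff {g x y : G} : Commute (g⁻¹ * x * g) y ↔ Commute x (g * y * g⁻¹) := by
  rw [← Commute.conj_iff g]
  simp [mul_assoc]

theorem commute_inv_conj {x y : G} (h : Commute x y) (g : G) :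
    Commute (g⁻¹ * x * g) (g⁻¹ * y * g) := by
  simpa using (Commute.conj_iff g⁻¹).2 h

theorem inv_mul_mul_eq_of_commute {x y : G} (h : Commute x y) : x⁻¹ * y * x = y := by
  rw [mul_assoc, ← h.eq, inv_mul_cancel_left]

/-- The cycle relation of a list `[s₁, …, sₘ]` of length 3 or 4: `s₁` commutes with the conjugate of
`sₘ` by `s₂ ⋯ sₘ₋₁`. No other length occurs, so other lists carry no relation. -/
def CycleRel : List G → Prop
  | [a, b, c] => Commute a (b * c * b⁻¹)
  | [a, b, c, d] => Commute a (b * c * d * c⁻¹ * b⁻¹)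
  | _ => True

theorem commute_triangle_rotate {a b c : G} (hab : Braided a b) (hca : Braided c a)
    (h : Commute a (b * c * b⁻¹)) : Commute b (c * a * c⁻¹) := by
  rw [← hca.inv_conj_eq, Commute.symm_iff, commute_conj_iff, ← hab.inv_conj_eq,
    Commute.symm_iff, commute_conj_iff]
  exact h

theorem commute_square_rotate {a b c d : G} (hab : Braided a b) (hda : Braided d a)
    (hac : Commute a c) (h : Commute a (b * c * d * c⁻¹ * b⁻¹)) :
    Commute b (c * d * a * d⁻¹ * c⁻¹) := by
  have h1 : c * d * a * d⁻¹ * c⁻¹ = a⁻¹ * (c * d * c⁻¹) * a := by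
    have h2 : c * a⁻¹ = a⁻¹ * c := (hac.inv_left.eq).symm
    have h3 : a * c⁻¹ = c⁻¹ * a := hac.inv_right.eq
    calc c * d * a * d⁻¹ * c⁻¹ = c * (d * a * d⁻¹) * c⁻¹ := by group
      _ = (c * a⁻¹) * d * (a * c⁻¹) := by rw [← hda.inv_conj_eq]; group
      _ = _ := by rw [h2, h3]; group
  rw [h1, Commute.symm_iff, commute_conj_iff, ← hab.inv_conj_eq, Commute.symm_iff,
    commute_conj_iff]
  simpa [mul_assoc] using h

/-- Along a path `a — b — c`, conjugating the last generator forward agrees with conjugating the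
first one backward. -/
theorem conj_path_eq {a b c : G} (hab : Braided a b) (hbc : Braided b c) (hac : Commute a c) :
    a * b * c * b⁻¹ * a⁻¹ = c⁻¹ * b⁻¹ * a * b * c := by
  have h2 : a * c⁻¹ = c⁻¹ * a := hac.inv_right.eq
  have h3 : c * a⁻¹ = a⁻¹ * c := (hac.inv_left.eq).symm
  calc a * b * c * b⁻¹ * a⁻¹ = a * (b * c * b⁻¹) * a⁻¹ := by group
    _ = (a * c⁻¹) * b * (c * a⁻¹) := by rw [← hbc.inv_conj_eq]; group
    _ = c⁻¹ * (a * b * a⁻¹) * c := by rw [h2, h3]; group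
    _ = _ := by rw [← hab.inv_conj_eq]; group

end Group

/-! ### Quivers with cycle relations -/

/-- A quiver on `V`, given by its list of arrows, together with a list of oriented cycles, each given
by the list of its vertices in cyclic order. -/
structure CycleQuiver (V : Type*) where
  arrows : List (V × V)
  cycles : List (List V)

namespace CycleQuiver

variable {V : Type*}

/-- The underlying graph of a quiver. -/
def graph (Q : CycleQuiver V) : SimpleGraph V :=
  SimpleGraph.fromRel fun i j => (i, j) ∈ Q.arrows

theorem adj_iff {Q : CycleQuiver V} {i j : V} :
    Q.graph.Adj i j ↔ i ≠ j ∧ ((i, j) ∈ Q.arrows ∨ (j, i) ∈ Q.arrows) := Iff.rfl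

instance [DecidableEq V] (Q : CycleQuiver V) : DecidableRel Q.graph.Adj :=
  fun _ _ => decidable_of_iff _ adj_iff.symm

/-- The quiver with all arrows, and all cycles, reversed. -/
def op (Q : CycleQuiver V) : CycleQuiver V where
  arrows := Q.arrows.map Prod.swap
  cycles := Q.cycles.map List.reverse

theorem op_graph (Q : CycleQuiver V) : Q.op.graph = Q.graph := by
  ext i j
  simp [adj_iff, op, or_comm]

theorem op_op (Q : CycleQuiver V) : Q.op.op = Q := by
  simp [op, Function.comp_def]

open scoped commutatorElement in
/-- The relator of a cycle. -/
def cycleRelator : List V → FreeGroup V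
  | [a, b, c] => ⁅FreeGroup.of a, .of b * .of c * (.of b)⁻¹⁆
  | [a, b, c, d] => ⁅FreeGroup.of a, .of b * .of c * .of d * (.of c)⁻¹ * (.of b)⁻¹⁆
  | _ => 1

/-- The relators of a quiver: the braid relators of its graph and the relators of its cycles. -/
def relators (Q : CycleQuiver V) : Set (FreeGroup V) :=
  braidRelators Q.graph ∪ {r | ∃ c ∈ Q.cycles, r = cycleRelator c}

/-- The family `s` of group elements satisfies the relations of `Q`. -/
structure Holds {G : Type*} [Group G] (Q : CycleQuiver V) (s : V → G) : Prop where
  braid : ∀ i j, Q.graph.Adj i j → Braided (s i) (s j)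
  comm : ∀ i j, ¬ Q.graph.Adj i j → Commute (s i) (s j)
  cycle : ∀ c ∈ Q.cycles, CycleRel (c.map s)

end CycleQuiver

theorem forall_braidRelators_iff {V G : Type*} [Group G] (Γ : SimpleGraph V) (s : V → G) :
    (∀ r ∈ braidRelators Γ, FreeGroup.lift s r = 1) ↔
      (∀ i j, Γ.Adj i j → Braided (s i) (s j)) ∧ (∀ i j, ¬ Γ.Adj i j → Commute (s i) (s j)) := by
  constructor
  · intro h
    constructor
    · intro i j hij
      have := h _ (Or.inl ⟨i, j, hij, rfl⟩)
      rw [map_mul, map_inv, mul_inv_eq_one] at this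
      simpa [Braided] using this
    · intro i j hij
      have := h _ (Or.inr ⟨i, j, hij, rfl⟩)
      rw [map_mul, map_inv, mul_inv_eq_one] at this
      simpa [commute_iff_eq] using this
  · rintro ⟨hb, hc⟩ r (⟨i, j, hij, rfl⟩ | ⟨i, j, hij, rfl⟩)
    · rw [map_mul, map_inv, mul_inv_eq_one]
      simpa [Braided] using hb i j hij
    · rw [map_mul, map_inv, mul_inv_eq_one]
      simpa using (hc i j hij).eq

namespace CycleQuiver

variable {V : Type*} {G : Type*} [Group G] {Q Q' : CycleQuiver V} {s : V → G}

theorem lift_cycleRelator_eq_one_iff (c : List V) :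
    FreeGroup.lift s (cycleRelator c) = 1 ↔ CycleRel (c.map s) := by
  match c with
  | [] | [_] | [_, _] | [_, _, _] | [_, _, _, _] | _ :: _ :: _ :: _ :: _ :: _ =>
    simp [cycleRelator, CycleRel, map_commutatorElement, commutatorElement_eq_one_iff_commute]

theorem holds_iff : Q.Holds s ↔ ∀ r ∈ Q.relators, FreeGroup.lift s r = 1 := by
  constructor
  · rintro h r (hr | ⟨c, hc, rfl⟩)
    · exact (forall_braidRelators_iff _ s).2 ⟨h.braid, h.comm⟩ r hr
    · exact (lift_cycleRelator_eq_one_iff c).2 (h.cycle c hc)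
  · intro h
    obtain ⟨hb, hc⟩ := (forall_braidRelators_iff Q.graph s).1 fun r hr => h r (Or.inl hr)
    exact ⟨hb, hc, fun c hc => (lift_cycleRelator_eq_one_iff c).1 (h _ (Or.inr ⟨c, hc, rfl⟩))⟩

theorem holds_of (Q : CycleQuiver V) :
    Q.Holds (PresentedGroup.of : V → PresentedGroup Q.relators) :=
  holds_iff.2 fun _ hr => lift_of_eq_one hr

/-- A list of vertices is a chordless cycle of length 3 or 4 of a graph. Opposite vertices of a
4-cycle are required to be non-adjacent, but not to be distinct, which the relations do not need. -/
def IsChordless (Γ : SimpleGraph V) : List V → Prop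
  | [a, b, c] => Γ.Adj a b ∧ Γ.Adj b c ∧ Γ.Adj c a
  | [a, b, c, d] =>
    Γ.Adj a b ∧ Γ.Adj b c ∧ Γ.Adj c d ∧ Γ.Adj d a ∧ ¬ Γ.Adj a c ∧ ¬ Γ.Adj b d
  | _ => False

instance (Γ : SimpleGraph V) [DecidableRel Γ.Adj] : DecidablePred (IsChordless Γ)
  | [_, _, _] | [_, _, _, _] => by unfold IsChordless; infer_instance
  | [] | [_] | [_, _] | _ :: _ :: _ :: _ :: _ :: _ => isFalse id

theorem IsChordless.reverse {Γ : SimpleGraph V} {c : List V} (hc : IsChordless Γ c) :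
    IsChordless Γ c.reverse := by
  match c with
  | [a, b, c] =>
    obtain ⟨h1, h2, h3⟩ := hc
    exact ⟨h2.symm, h1.symm, h3.symm⟩
  | [a, b, c, d] =>
    obtain ⟨h1, h2, h3, h4, h5, h6⟩ := hc
    exact ⟨h3.symm, h2.symm, h1.symm, h4.symm, fun h => h6 h.symm, fun h => h5 h.symm⟩

theorem IsChordless.rotate_one {Γ : SimpleGraph V} {c : List V} (hc : IsChordless Γ c) :
    IsChordless Γ (c.rotate 1) := by
  match c with
  | [a, b, c] =>
    obtain ⟨h1, h2, h3⟩ := hc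
    exact ⟨h2, h3, h1⟩
  | [a, b, c, d] =>
    obtain ⟨h1, h2, h3, h4, h5, h6⟩ := hc
    exact ⟨h2, h3, h4, h1, h6, fun h => h5 h.symm⟩

theorem IsChordless.of_isRotated {Γ : SimpleGraph V} {c d : List V} (hc : IsChordless Γ c)
    (hcd : c ~r d) : IsChordless Γ d := by
  obtain ⟨n, rfl⟩ := hcd
  induction n with
  | zero => simpa using hc
  | succ n ih => simpa using ih.rotate_one

theorem IsChordless.cycleRel_rotate_one {c : List V} (hc : IsChordless Q.graph c)
    (hb : ∀ i j, Q.graph.Adj i j → Braided (s i) (s j))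
    (hn : ∀ i j, ¬ Q.graph.Adj i j → Commute (s i) (s j)) (h : CycleRel (c.map s)) :
    CycleRel ((c.rotate 1).map s) := by
  match c with
  | [a, b, c] =>
    obtain ⟨h1, h2, h3⟩ := hc
    exact commute_triangle_rotate (hb _ _ h1) (hb _ _ h3) h
  | [a, b, c, d] =>
    obtain ⟨h1, h2, h3, h4, h5, h6⟩ := hc
    exact commute_square_rotate (hb _ _ h1) (hb _ _ h4) (hn _ _ h5) h

/-- Modulo the braid relations, the relations of a chordless cycle for its different starting points
are equivalent. -/
theorem IsChordless.cycleRel_of_isRotated {c d : List V} (hc : IsChordless Q.graph c)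
    (hb : ∀ i j, Q.graph.Adj i j → Braided (s i) (s j))
    (hn : ∀ i j, ¬ Q.graph.Adj i j → Commute (s i) (s j)) (hcd : c ~r d)
    (h : CycleRel (c.map s)) : CycleRel (d.map s) := by
  obtain ⟨n, rfl⟩ := hcd
  induction n with
  | zero => simpa using h
  | succ n ih => simpa using (hc.of_isRotated ⟨n, rfl⟩).cycleRel_rotate_one hb hn ih

/-- Inverting all generators exchanges the relations of a quiver with those of its opposite. -/
theorem Holds.op (hQ : ∀ c ∈ Q.cycles, IsChordless Q.graph c) (h : Q.Holds s) :
    Q.op.Holds (fun i => (s i)⁻¹) where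
  braid i j hij := (h.braid i j (by rwa [op_graph] at hij)).inv
  comm i j hij := (h.comm i j (by rwa [op_graph] at hij)).inv_inv
  cycle c hc := by
    obtain ⟨c, hc', rfl⟩ := List.mem_map.1 hc
    have hch := hQ c hc'
    have hr := h.cycle c hc'
    match c with
    | [a, b, c] =>
      obtain ⟨h1, h2, h3⟩ := hch
      have := commute_triangle_rotate (h.braid _ _ h2) (h.braid _ _ h1)
        (commute_triangle_rotate (h.braid _ _ h1) (h.braid _ _ h3) hr)
      rw [← (h.braid _ _ h1).inv_conj_eq] at this
      change Commute (s c)⁻¹ ((s b)⁻¹ * (s a)⁻¹ * (s b)⁻¹⁻¹)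
      rw [show (s b)⁻¹ * (s a)⁻¹ * (s b)⁻¹⁻¹ = ((s b)⁻¹ * s a * s b)⁻¹ by group]
      exact this.inv_inv
    | [a, b, c, d] =>
      obtain ⟨h1, h2, h3, h4, h5, h6⟩ := hch
      have h7 : CycleRel ([d, a, b, c].map s) :=
        IsChordless.cycleRel_of_isRotated (Q := Q) (c := [a, b, c, d]) (hQ _ hc') h.braid h.comm
          ⟨3, rfl⟩ hr
      change Commute _ _ at h7
      rw [conj_path_eq (h.braid _ _ h1) (h.braid _ _ h2) (h.comm _ _ h5)] at h7
      change Commute (s d)⁻¹ ((s c)⁻¹ * (s b)⁻¹ * (s a)⁻¹ * (s b)⁻¹⁻¹ * (s c)⁻¹⁻¹)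
      rw [show (s c)⁻¹ * (s b)⁻¹ * (s a)⁻¹ * (s b)⁻¹⁻¹ * (s c)⁻¹⁻¹ =
        ((s c)⁻¹ * (s b)⁻¹ * s a * s b * s c)⁻¹ by group]
      exact h7.inv_inv

/-! ### Mutation -/

/-- The arrows of a cycle of vertices. -/
def cycleArrows (c : List V) : List (V × V) := c.zip (c.rotate 1)

/-- The new family of generators after a mutation at `k`: the generators of the vertices with an
arrow to `k` are conjugated. -/
def mutateFamily [DecidableEq V] (Q : CycleQuiver V) (k : V) (s : V → G) (i : V) : G :=
  if (i, k) ∈ Q.arrows then (s k)⁻¹ * s i * s k else s i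

/-- The relation of the cycle `c` after a mutation of `Q` at `k` is a consequence of the relations of
`Q`, because `c` is of one of the following kinds: a cycle of `Q` that avoids `k`; a triangle that
arises from a 4-cycle of `Q` through `k` by a shortcut; a triangle created at `k`; a 4-cycle that
arises from a triangle of `Q` by a detour through `k`. The starting points of the cycles are those
for which the relation carries over without further rewriting. -/
def IsMutatedCycle (Q : CycleQuiver V) (k : V) (c : List V) : Prop :=
  (c ∈ Q.cycles ∧ k ∉ c ∧ ((∀ i ∈ c, (i, k) ∉ Q.arrows) ∨ ∀ i ∈ c, (k, i) ∉ Q.arrows)) ∨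
  match c with
  | [u, v, w] =>
    ((u, k) ∈ Q.arrows ∧ (v, k) ∉ Q.arrows ∧ (w, k) ∉ Q.arrows ∧
      ∃ d ∈ Q.cycles, d ~r [u, k, v, w]) ∨
    (v = k ∧ (w, k) ∈ Q.arrows ∧ (u, k) ∉ Q.arrows ∧ (k, k) ∉ Q.arrows ∧ ¬ Q.graph.Adj u w)
  | [a, x, b, w] =>
    x = k ∧ (b, k) ∈ Q.arrows ∧ (a, k) ∉ Q.arrows ∧ (k, k) ∉ Q.arrows ∧ ¬ Q.graph.Adj k w ∧
      ∃ d ∈ Q.cycles, d ~r [a, b, w]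
  | _ => False

/-- The quiver `Q'` is, as far as its relations are concerned, the mutation of `Q` at `k`: adjacency
changes exactly at the ends of paths `i → k → j`, which gain an edge or lose the third edge of a
triangle of `Q`; all cycles are chordless; and each cycle of `Q'` has a rotation that is a mutated
cycle. -/
def IsMutation (Q : CycleQuiver V) (k : V) (Q' : CycleQuiver V) : Prop :=
  (∀ i, (i, k) ∈ Q.arrows → (k, i) ∉ Q.arrows) ∧
  (∀ i, Q'.graph.Adj i k ↔ Q.graph.Adj i k) ∧
  (∀ i, i ≠ k → ∀ j, j ≠ k → (i, k) ∈ Q.arrows → (k, j) ∈ Q.arrows →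
    (Q'.graph.Adj i j ∧ ¬ Q.graph.Adj i j) ∨
      (¬ Q'.graph.Adj i j ∧ ∃ c ∈ Q.cycles, c ~r [i, k, j])) ∧
  (∀ i, i ≠ k → ∀ j, j ≠ k → ¬ ((i, k) ∈ Q.arrows ∧ (k, j) ∈ Q.arrows) →
    ¬ ((j, k) ∈ Q.arrows ∧ (k, i) ∈ Q.arrows) → (Q'.graph.Adj i j ↔ Q.graph.Adj i j)) ∧
  (∀ c ∈ Q.cycles, IsChordless Q.graph c) ∧ (∀ c ∈ Q'.cycles, IsChordless Q'.graph c) ∧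
  (∀ c ∈ Q'.cycles, ∃ d ∈ c.cyclicPermutations, IsMutatedCycle Q k d)

instance [DecidableEq V] (Q : CycleQuiver V) (k : V) : DecidablePred (IsMutatedCycle Q k)
  | [_, _, _] | [_, _, _, _] => by unfold IsMutatedCycle; infer_instance
  | [] | [_] | [_, _] | _ :: _ :: _ :: _ :: _ :: _ => by unfold IsMutatedCycle; infer_instance

set_option synthInstance.maxSize 1000 in
instance [DecidableEq V] [Fintype V] (Q Q' : CycleQuiver V) (k : V) :
    Decidable (IsMutation Q k Q') := by
  unfold IsMutation
  infer_instance

theorem Holds.cycleRel_of_isRotated (h : Q.Holds s) (hQ : ∀ c ∈ Q.cycles, IsChordless Q.graph c)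
    {c d : List V} (hc : c ∈ Q.cycles) (hcd : c ~r d) : CycleRel (d.map s) :=
  (hQ c hc).cycleRel_of_isRotated h.braid h.comm hcd (h.cycle c hc)

section Mutation

variable [DecidableEq V] {k : V}

theorem mutateFamily_of_not_mem {i : V} (hi : (i, k) ∉ Q.arrows) :
    Q.mutateFamily k s i = s i := if_neg hi

theorem mutateFamily_of_mem {i : V} (hi : (i, k) ∈ Q.arrows) :
    Q.mutateFamily k s i = (s k)⁻¹ * s i * s k := if_pos hi

/-- Generators that do not receive an arrow from `k` are all conjugated by the mutation, since those
not joined to `k` commute with the generator of `k`. -/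
theorem mutateFamily_of_not_mem_swap (h : Q.Holds s) {i : V} (hi : (k, i) ∉ Q.arrows) :
    Q.mutateFamily k s i = (s k)⁻¹ * s i * s k := by
  by_cases hik : (i, k) ∈ Q.arrows
  · exact mutateFamily_of_mem hik
  · rw [mutateFamily_of_not_mem hik]
    refine (inv_mul_mul_eq_of_commute (h.comm k i ?_)).symm
    simp [adj_iff, hik, hi]

theorem CycleRel.inv_conj {l : List G} (h : CycleRel l) (g : G) :
    CycleRel (l.map fun x => g⁻¹ * x * g) := by
  match l with
  | [] | [_] | [_, _] | _ :: _ :: _ :: _ :: _ :: _ => trivial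
  | [a, b, c] =>
    have := commute_inv_conj (show Commute _ _ from h) g
    simpa [CycleRel, mul_assoc] using this
  | [a, b, c, d] =>
    have := commute_inv_conj (show Commute _ _ from h) g
    simpa [CycleRel, mul_assoc] using this

theorem IsMutatedCycle.cycleRel {c : List V} (hc : IsMutatedCycle Q k c) (h : Q.Holds s)
    (hQ : ∀ c ∈ Q.cycles, IsChordless Q.graph c) :
    CycleRel (c.map (Q.mutateFamily k s)) := by
  rcases hc with ⟨hc, -, hin | hout⟩ | hc
  · rw [List.map_congr_left (g := s) fun i hi => mutateFamily_of_not_mem (hin i hi)]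
    exact h.cycle c hc
  · rw [List.map_congr_left (g := fun i => (s k)⁻¹ * s i * s k)
      fun i hi => mutateFamily_of_not_mem_swap h (hout i hi)]
    simpa [Function.comp_def] using CycleRel.inv_conj (h.cycle c hc) (s k)
  · match c with
    | [u, v, w] =>
      rcases hc with ⟨hu, hv, hw, d, hd, hr⟩ | ⟨rfl, hw, hu, hk, huw⟩
      · have := h.cycleRel_of_isRotated hQ hd hr
        change Commute _ _
        rw [mutateFamily_of_mem hu, mutateFamily_of_not_mem hv, mutateFamily_of_not_mem hw,
          commute_conj_iff]
        simpa [CycleRel, mul_assoc] using this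
      · change Commute _ _
        rw [mutateFamily_of_mem hw, mutateFamily_of_not_mem hu, mutateFamily_of_not_mem hk]
        simpa [mul_assoc] using h.comm u w huw
    | [a, x, b, w] =>
      obtain ⟨rfl, hb, ha, hk, hw, d, hd, hr⟩ := hc
      have h1 := h.cycleRel_of_isRotated hQ hd hr
      have h2 : Commute (s x) (s w) := h.comm _ _ hw
      have hw' : (w, x) ∉ Q.arrows := fun hwx => by
        by_cases hxw : x = w
        · exact hk (by simpa [← hxw] using hwx)
        · exact hw (adj_iff.2 ⟨hxw, .inr hwx⟩)
      change Commute _ _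
      rw [mutateFamily_of_mem hb, mutateFamily_of_not_mem ha, mutateFamily_of_not_mem hk,
        mutateFamily_of_not_mem hw']
      rw [show s x * ((s x)⁻¹ * s b * s x) * s w * ((s x)⁻¹ * s b * s x)⁻¹ * (s x)⁻¹ =
        s b * (s x * s w * (s x)⁻¹) * (s b)⁻¹ by group, h2.eq, mul_inv_cancel_right]
      exact h1

/-- The mutated family of generators satisfies the relations of the mutated quiver. -/
theorem IsMutation.holds (hm : IsMutation Q k Q') (h : Q.Holds s) :
    Q'.Holds (Q.mutateFamily k s) := by
  obtain ⟨hanti, hk, hpath, hother, hQ, hQ', hcyc⟩ := hm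
  have hkk : (k, k) ∉ Q.arrows := fun h => hanti k h h
  have key : ∀ i, i ≠ k → (k, i) ∉ Q.arrows → ∀ j, j ≠ k → (k, j) ∈ Q.arrows →
      (Q'.graph.Adj i j → Braided (Q.mutateFamily k s i) (Q.mutateFamily k s j)) ∧
      (¬ Q'.graph.Adj i j → Commute (Q.mutateFamily k s i) (Q.mutateFamily k s j)) := by
    intro i hik hki j hjk hkj
    have hjk' : (j, k) ∉ Q.arrows := fun h => hanti j h hkj
    rw [mutateFamily_of_not_mem hjk']
    by_cases hi : (i, k) ∈ Q.arrows
    · rw [mutateFamily_of_mem hi]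
      have hbik : Braided (s i) (s k) := h.braid _ _ (adj_iff.2 ⟨hik, .inl hi⟩)
      have hbjk : Braided (s j) (s k) := h.braid _ _ (adj_iff.2 ⟨hjk, .inr hkj⟩)
      rcases hpath i hik j hjk hi hkj with ⟨h1, h2⟩ | ⟨h1, c, hc, hr⟩
      · refine ⟨fun _ => ?_, fun h => absurd h1 h⟩
        -- conjugating by `s i`, which commutes with `s j`, turns `k⁻¹ i k = i k i⁻¹` into `k`
        have := hbjk.symm.conj (s i)⁻¹
        rw [hbik.inv_conj_eq]
        rwa [inv_mul_mul_eq_of_commute (h.comm i j h2).inv_left, inv_inv] at this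
      · refine ⟨fun h => absurd h h1, fun _ => ?_⟩
        rw [commute_conj_iff]
        exact h.cycleRel_of_isRotated hQ hc hr
    · rw [mutateFamily_of_not_mem hi]
      have := hother i hik j hjk (fun h => hi h.1) (fun h => hjk' h.1)
      rw [this]
      exact ⟨h.braid i j, h.comm i j⟩
  have pair : ∀ i j,
      (Q'.graph.Adj i j → Braided (Q.mutateFamily k s i) (Q.mutateFamily k s j)) ∧
      (¬ Q'.graph.Adj i j → Commute (Q.mutateFamily k s i) (Q.mutateFamily k s j)) := by
    have conj : ∀ i j, (k, i) ∉ Q.arrows → (k, j) ∉ Q.arrows →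
        (Q'.graph.Adj i j ↔ Q.graph.Adj i j) →
        (Q'.graph.Adj i j → Braided (Q.mutateFamily k s i) (Q.mutateFamily k s j)) ∧
        (¬ Q'.graph.Adj i j → Commute (Q.mutateFamily k s i) (Q.mutateFamily k s j)) := by
      intro i j hi hj hij
      rw [mutateFamily_of_not_mem_swap h hi, mutateFamily_of_not_mem_swap h hj, hij]
      exact ⟨fun hij => (h.braid i j hij).conj _, fun hij => commute_inv_conj (h.comm i j hij) _⟩
    have same : ∀ i j, (i, k) ∉ Q.arrows → (j, k) ∉ Q.arrows →
        (Q'.graph.Adj i j ↔ Q.graph.Adj i j) →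
        (Q'.graph.Adj i j → Braided (Q.mutateFamily k s i) (Q.mutateFamily k s j)) ∧
        (¬ Q'.graph.Adj i j → Commute (Q.mutateFamily k s i) (Q.mutateFamily k s j)) := by
      intro i j hi hj hij
      rw [mutateFamily_of_not_mem hi, mutateFamily_of_not_mem hj, hij]
      exact ⟨h.braid i j, h.comm i j⟩
    have atk : ∀ i, (Q'.graph.Adj i k → Braided (Q.mutateFamily k s i) (Q.mutateFamily k s k)) ∧
        (¬ Q'.graph.Adj i k → Commute (Q.mutateFamily k s i) (Q.mutateFamily k s k)) := by
      intro i
      by_cases hi : (i, k) ∈ Q.arrows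
      · exact conj i k (hanti i hi) hkk (hk i)
      · exact same i k hi hkk (hk i)
    intro i j
    by_cases hjk : j = k
    · exact hjk ▸ atk i
    by_cases hik : i = k
    · rw [hik]
      obtain ⟨h1, h2⟩ := atk j
      exact ⟨fun h => (h1 h.symm).symm, fun hn => (h2 fun h => hn h.symm).symm⟩
    by_cases hi : (k, i) ∈ Q.arrows <;> by_cases hj : (k, j) ∈ Q.arrows
    · exact same i j (fun h => hanti i h hi) (fun h => hanti j h hj)
        (hother i hik j hjk (fun h => hanti i h.1 hi) (fun h => hanti j h.1 hj))
    · obtain ⟨h1, h2⟩ := key j hjk hj i hik hi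
      exact ⟨fun h => (h1 h.symm).symm, fun hn => (h2 fun h => hn h.symm).symm⟩
    · exact key i hik hi j hjk hj
    · exact conj i j hi hj (hother i hik j hjk (fun h => hj h.2) (fun h => hi h.2))
  refine ⟨fun i j => (pair i j).1, fun i j => (pair i j).2, fun c hc => ?_⟩
  obtain ⟨d, hd, hmut⟩ := hcyc c hc
  have hdc : d ~r c := List.mem_cyclicPermutations_iff.1 hd
  exact ((hQ' c hc).of_isRotated hdc.symm).cycleRel_of_isRotated (fun i j => (pair i j).1)
    (fun i j => (pair i j).2) hdc (hmut.cycleRel h hQ)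

end Mutation

/-- A quiver and its opposite have isomorphic groups. -/
theorem nonempty_mulEquiv_op (hQ : ∀ c ∈ Q.cycles, IsChordless Q.graph c) :
    Nonempty (PresentedGroup Q.relators ≃* PresentedGroup Q.op.relators) := by
  have hop : ∀ c ∈ Q.op.cycles, IsChordless Q.op.graph c := by
    rw [op_graph]
    intro c hc
    obtain ⟨d, hd, rfl⟩ := List.mem_map.1 hc
    exact (hQ d hd).reverse
  have hy := holds_iff.1 (Holds.op hQ Q.holds_of)
  have hx := holds_iff.1 (Holds.op hop Q.op.holds_of)
  rw [op_op] at hx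
  exact nonempty_mulEquiv_of_generators _ _ hx hy (by simp) (by simp)

/-- A mutation does not change the group of a quiver. Its inverse is the mutation of the opposite
quivers, transported by the inversion of the generators. -/
theorem IsMutation.nonempty_mulEquiv [DecidableEq V] {k : V} (hm : IsMutation Q k Q')
    (hm' : IsMutation Q'.op k Q.op) (hk : ∀ i, (k, i) ∈ Q'.arrows ↔ (i, k) ∈ Q.arrows) :
    Nonempty (PresentedGroup Q.relators ≃* PresentedGroup Q'.relators) := by
  have hQ := hm.2.2.2.2.1
  have hQ' := hm.2.2.2.2.2.1
  have hop : ∀ c ∈ Q.op.cycles, IsChordless Q.op.graph c := hm'.2.2.2.2.2.1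
  have hkk : (k, k) ∉ Q.arrows := fun h => hm.1 k h h
  have hx := (hm'.holds (Holds.op hQ' Q'.holds_of)).op hop
  rw [op_op] at hx
  have hy := hm.holds Q.holds_of
  have hmem : ∀ i, (i, k) ∈ Q'.op.arrows ↔ (i, k) ∈ Q.arrows := by
    intro i; rw [← hk]; simp [op]
  refine nonempty_mulEquiv_of_generators _ _ (holds_iff.1 hx) (holds_iff.1 hy) (fun i => ?_)
    (fun i => ?_) <;> by_cases hi : (i, k) ∈ Q.arrows <;>
    simp [mutateFamily, hmem, hi, hkk, mul_assoc]

/-! ### Mutation as an algorithm -/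

section Certificate

variable [DecidableEq V]

/-- The mutation of a quiver at `k`: the arrows at `k` are reversed and each path `i → k → j` adds an
arrow `i → j`, which cancels an arrow `j → i`. A triangle through `k` disappears, a 4-cycle through
`k` loses `k`, a cycle with an arrow `i → j` such that `j → k → i` has `k` inserted between `i` and
`j`, and each new arrow gives a new triangle. -/
def mutate (Q : CycleQuiver V) (k : V) : CycleQuiver V :=
  let new := ((Q.arrows.filter (·.2 = k)).product (Q.arrows.filter (·.1 = k))).filterMap fun e =>
    if (e.2.2, e.1.1) ∈ Q.arrows then none else some (e.1.1, e.2.2)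
  { arrows := new ++ (Q.arrows.filter fun e => ¬ ((e.2, k) ∈ Q.arrows ∧ (k, e.1) ∈ Q.arrows)).map
      fun e => if e.1 = k ∨ e.2 = k then e.swap else e
    cycles := new.map (fun e => [e.2, k, e.1]) ++ Q.cycles.filterMap fun c =>
      if k ∈ c then (if c.length = 4 then some (c.erase k) else none)
      else some ((cycleArrows c).flatMap fun e =>
        if (e.2, k) ∈ Q.arrows ∧ (k, e.1) ∈ Q.arrows then [e.1, k] else [e.1]) }

/-- The mutation of a quiver along a list of vertices. -/
def mutateList (Q : CycleQuiver V) (ks : List V) : CycleQuiver V := ks.foldl mutate Q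

/-- Each step of the mutation of `Q` along the list preserves the group. -/
def IsMutable (Q : CycleQuiver V) : List V → Prop
  | [] => True
  | k :: ks => (IsMutation Q k (Q.mutate k) ∧ IsMutation (Q.mutate k).op k Q.op ∧
      ∀ i, (k, i) ∈ (Q.mutate k).arrows ↔ (i, k) ∈ Q.arrows) ∧ (Q.mutate k).IsMutable ks

instance IsMutable.decidable [Fintype V] (Q : CycleQuiver V) :
    (ks : List V) → Decidable (Q.IsMutable ks)
  | [] => isTrue trivial
  | k :: ks => by
    have := IsMutable.decidable (Q.mutate k) ks
    unfold IsMutable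
    infer_instance

theorem IsMutable.nonempty_mulEquiv {Q : CycleQuiver V} {ks : List V} (h : Q.IsMutable ks) :
    Nonempty (PresentedGroup Q.relators ≃* PresentedGroup (Q.mutateList ks).relators) := by
  induction ks generalizing Q with
  | nil => exact ⟨MulEquiv.refl _⟩
  | cons k ks ih =>
    obtain ⟨⟨h1, h2, h3⟩, h4⟩ := h
    exact ⟨(h1.nonempty_mulEquiv h2 h3).some.trans (ih h4).some⟩

end Certificate

end CycleQuiver

/-! ### Orientations and cycle commutators -/

namespace CycleQuiver

section Orientation

variable {V : Type*}

/-- The cycles of `Q` are 4-cycles of its graph and make up, up to rotation and reversal, all its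
4-cycles; and they all share an arrow with one of them, so that orienting one of them consistently
orients all. -/
def ListsFourCycles (Q : CycleQuiver V) : Prop :=
  (∀ c ∈ Q.cycles, c.length = 4 ∧ c.Nodup ∧ IsChordless Q.graph c) ∧
  (∀ a b, Q.graph.Adj a b → ∀ c, Q.graph.Adj b c → a ≠ c → ∀ d, Q.graph.Adj c d →
    Q.graph.Adj d a → b ≠ d → ∃ e ∈ Q.cycles, e ~r [a, b, c, d] ∨ e.reverse ~r [a, b, c, d]) ∧
  ∃ r ∈ Q.cycles, ∀ c ∈ Q.cycles, ∃ e ∈ cycleArrows c, e ∈ cycleArrows r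

instance [DecidableEq V] [Fintype V] (Q : CycleQuiver V) : Decidable Q.ListsFourCycles := by
  unfold ListsFourCycles
  infer_instance

theorem swap_mem_cycleArrows_of_reverse {c : List V} (hc : c.length = 4) {e : V × V}
    (he : e ∈ cycleArrows c.reverse) : e.swap ∈ cycleArrows c := by
  match c with
  | [a, b, c, d] =>
    simp only [cycleArrows, List.reverse_cons, List.reverse_nil, List.nil_append, List.cons_append,
      List.rotate_cons_succ, List.rotate_zero, List.zip_cons_cons, List.zip_nil_right,
      List.mem_cons, List.not_mem_nil, or_false] at he ⊢
    rcases he with rfl | rfl | rfl | rfl <;> simp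

theorem cycleArrows_isRotated {c d : List V} (h : c ~r d) : cycleArrows c ~r cycleArrows d := by
  obtain ⟨n, rfl⟩ := h
  refine ⟨n, ?_⟩
  rw [cycleArrows, cycleArrows, List.zip_eq_zipWith, List.zip_eq_zipWith,
    List.zipWith_rotate_distrib _ _ _ _ (by simp), List.rotate_rotate, List.rotate_rotate,
    Nat.add_comm]

variable {Γ : SimpleGraph V} {D : Digraph V} {C : Set (Fin 4 → V)} {Q : CycleQuiver V}

theorem ofFn_rotate_isRotated (c : Fin 4 → V) (k : Fin 4) :
    List.ofFn c ~r List.ofFn fun i => c (i + k) := by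
  refine ⟨k, ?_⟩
  fin_cases k <;> rfl

theorem isFourCycle_get {a b c d : V} (hn : [a, b, c, d].Nodup) (hab : Γ.Adj a b)
    (hbc : Γ.Adj b c) (hcd : Γ.Adj c d) (hda : Γ.Adj d a) : IsFourCycle Γ ![a, b, c, d] := by
  refine ⟨?_, fun i => by fin_cases i <;> assumption⟩
  rw [← List.nodup_ofFn]
  simpa using hn

theorem ListsFourCycles.op (hQ : Q.ListsFourCycles) : Q.op.ListsFourCycles := by
  obtain ⟨h1, h2, r, hr, h3⟩ := hQ
  have hrev : ∀ c : List V, c.length = 4 → ∀ e ∈ cycleArrows c, e.swap ∈ cycleArrows c.reverse := by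
    intro c hc e he
    exact swap_mem_cycleArrows_of_reverse (by simpa using hc) (by simpa using he)
  refine ⟨?_, ?_, r.reverse, List.mem_map_of_mem hr, ?_⟩
  · rw [op_graph]
    intro c hc
    obtain ⟨d, hd, rfl⟩ := List.mem_map.1 hc
    obtain ⟨h4, hn, hch⟩ := h1 d hd
    exact ⟨by simpa using h4, by simpa using hn, hch.reverse⟩
  · rw [op_graph]
    intro a b hab c hbc hac d hcd hda hbd
    obtain ⟨e, he, her⟩ := h2 a b hab c hbc hac d hcd hda hbd
    exact ⟨e.reverse, List.mem_map_of_mem he, by simpa using her.symm⟩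
  · intro c hc
    obtain ⟨d, hd, rfl⟩ := List.mem_map.1 hc
    obtain ⟨e, he, her⟩ := h3 d hd
    exact ⟨e.swap, hrev d (h1 d hd).1 e he, hrev r (h1 r hr).1 e her⟩

theorem lift_cycleCommutator_eq_one_iff {G : Type*} [Group G] {s : V → G} (c : Fin 4 → V) :
    FreeGroup.lift s (cycleCommutator c) = 1 ↔ CycleRel ((List.ofFn c).map s) :=
  lift_cycleRelator_eq_one_iff (s := s) [c 0, c 1, c 2, c 3]

/-- If the orientation `D` agrees with the cyclic orders of the cycles of `Q`, then the relations of
`Q` are equivalent to the braid relations and the cycle commutators of any transversal. -/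
theorem holds_iff_of_forall_adj (hΓ : Q.graph = Γ) (hD : IsCycleOrientation Γ D)
    (hC : IsCycleTransversal D C) (hQ : Q.ListsFourCycles)
    (hf : ∀ c ∈ Q.cycles, ∀ e ∈ cycleArrows c, D.Adj e.1 e.2) {G : Type*} [Group G] (s : V → G) :
    Q.Holds s ↔ ∀ r ∈ braidRelators Γ ∪ cycleCommutator '' C, FreeGroup.lift s r = 1 := by
  obtain ⟨h1, h2, -⟩ := hQ
  subst hΓ
  have hrot : ∀ c ∈ Q.cycles, ∀ d, c ~r d → ∀ e ∈ cycleArrows d, D.Adj e.1 e.2 :=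
    fun c hc d hcd e he => hf c hc e ((cycleArrows_isRotated hcd).mem_iff.2 he)
  constructor
  · rintro h r (hr | ⟨c, hc, rfl⟩)
    · exact (forall_braidRelators_iff _ s).2 ⟨h.braid, h.comm⟩ r hr
    · rw [lift_cycleCommutator_eq_one_iff]
      obtain ⟨hinj, hor⟩ := hC.isOriented c hc
      have hadj : ∀ i, Q.graph.Adj (c i) (c (i + 1)) := fun i => (hD.adj_iff _ _).2 (.inl (hor i))
      obtain ⟨e, he, her | her⟩ := h2 (c 0) (c 1) (hadj 0) (c 2) (hadj 1) (hinj.ne (by decide))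
        (c 3) (hadj 2) (hadj 3) (hinj.ne (by decide))
      · exact h.cycleRel_of_isRotated (fun c hc => (h1 c hc).2.2) he her
      · -- the reversed cycle cannot be oriented as well
        have her' : e ~r [c 3, c 2, c 1, c 0] := by simpa using her.reverse
        exact absurd (hor 2) (hD.asymm _ _ (hrot e he _ her' (c 3, c 2) (by simp [cycleArrows])))
  · intro h
    obtain ⟨hb, hn⟩ := (forall_braidRelators_iff Q.graph s).1 fun r hr => h r (Or.inl hr)
    refine ⟨hb, hn, fun c hc => ?_⟩
    obtain ⟨hlen, hnodup, hch⟩ := h1 c hc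
    have hfc := hf c hc
    match c with
    | [a, b, c, d] =>
      obtain ⟨k, hk, -⟩ := hC.existsUnique ![a, b, c, d]
        ⟨(isFourCycle_get hnodup hch.1 hch.2.1 hch.2.2.1 hch.2.2.2.1).1, fun i => by
          fin_cases i
          · exact hfc (a, b) (by simp [cycleArrows])
          · exact hfc (b, c) (by simp [cycleArrows])
          · exact hfc (c, d) (by simp [cycleArrows])
          · exact hfc (d, a) (by simp [cycleArrows])⟩
      have hrel := (lift_cycleCommutator_eq_one_iff _).1 (h _ (.inr ⟨_, hk, rfl⟩))
      have hr := (ofFn_rotate_isRotated ![a, b, c, d] k).symm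
      exact (hch.of_isRotated hr.symm).cycleRel_of_isRotated hb hn hr hrel

theorem nonempty_mulEquiv_diagramGroup_of_forall_adj (hΓ : Q.graph = Γ)
    (hD : IsCycleOrientation Γ D) (hC : IsCycleTransversal D C) (hQ : Q.ListsFourCycles)
    (hf : ∀ c ∈ Q.cycles, ∀ e ∈ cycleArrows c, D.Adj e.1 e.2) :
    Nonempty (PresentedGroup Q.relators ≃* DiagramGroup Γ C) := by
  refine nonempty_mulEquiv_of_generators (x := PresentedGroup.of) (y := PresentedGroup.of) ?_ ?_
    (fun _ => PresentedGroup.toGroup.of _) (fun _ => PresentedGroup.toGroup.of _)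
  · rw [← holds_iff, holds_iff_of_forall_adj hΓ hD hC hQ hf]
    exact fun r hr => lift_of_eq_one hr
  · rw [← holds_iff_of_forall_adj hΓ hD hC hQ hf]
    exact Q.holds_of

/-- The group of a diagram does not depend on the orientation, because there are only two
orientations of the 4-cycles and they are exchanged by inverting the generators. -/
theorem nonempty_mulEquiv_diagramGroup (hΓ : Q.graph = Γ) (hD : IsCycleOrientation Γ D)
    (hC : IsCycleTransversal D C) (hQ : Q.ListsFourCycles) :
    Nonempty (PresentedGroup Q.relators ≃* DiagramGroup Γ C) := by
  obtain ⟨h1, -, r, hr, h3⟩ := id hQ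
  have hor : ∀ c ∈ Q.cycles, (∀ e ∈ cycleArrows c, D.Adj e.1 e.2) ∨
      ∀ e ∈ cycleArrows c, D.Adj e.2 e.1 := by
    intro c hc
    obtain ⟨hlen, hnodup, hch⟩ := h1 c hc
    rw [hΓ] at hch
    match c with
    | [a, b, c, d] =>
      refine (hD.oriented ![a, b, c, d]
        (isFourCycle_get hnodup hch.1 hch.2.1 hch.2.2.1 hch.2.2.2.1)).imp ?_ ?_ <;>
      · intro h
        have h0 := h 0
        have h1 := h 1
        have h2 := h 2
        have h3 := h 3
        simp only [cycleArrows, List.rotate_cons_succ, List.rotate_zero, List.cons_append,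
          List.nil_append, List.zip_cons_cons, List.zip_nil_right, List.forall_mem_cons]
        exact ⟨h0, h1, h2, h3, by simp⟩
  rcases hor r hr with hfr | hbr
  · refine nonempty_mulEquiv_diagramGroup_of_forall_adj hΓ hD hC hQ fun c hc => ?_
    obtain ⟨e, he, her⟩ := h3 c hc
    exact (hor c hc).resolve_right fun hb => hD.asymm _ _ (hfr e her) (hb e he)
  · obtain ⟨φ⟩ := nonempty_mulEquiv_op fun c hc => (h1 c hc).2.2
    obtain ⟨ψ⟩ := nonempty_mulEquiv_diagramGroup_of_forall_adj (Q.op_graph.trans hΓ) hD hC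
        hQ.op <| by
      intro c hc e he
      obtain ⟨d, hd, rfl⟩ := List.mem_map.1 hc
      obtain ⟨f, hf, hfr⟩ := h3 d hd
      have hb := (hor d hd).resolve_left fun h => hD.asymm _ _ (h f hf) (hbr f hfr)
      exact hb e.swap (swap_mem_cycleArrows_of_reverse (h1 d hd).1 he)
    exact ⟨φ.trans ψ⟩

end Orientation

/-! ### Trees and Artin groups -/

section Artin

variable {V B : Type*}

/-- The quiver `Q` has no cycles, and `σ` identifies its graph with the Coxeter diagram of a
simply laced Coxeter matrix `M`. -/
def IsCoxeterTree [DecidableEq V] (Q : CycleQuiver V) (M : CoxeterMatrix B) (σ : V → B) : Prop :=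
  Q.cycles = [] ∧ Function.Bijective σ ∧
    ∀ i j, M (σ i) (σ j) = if i = j then 1 else if Q.graph.Adj i j then 3 else 2

instance [DecidableEq V] [Fintype V] [DecidableEq B] [Fintype B] (Q : CycleQuiver V)
    (M : CoxeterMatrix B) (σ : V → B) : Decidable (Q.IsCoxeterTree M σ) := by
  unfold IsCoxeterTree
  infer_instance

theorem IsCoxeterTree.holds_iff [DecidableEq V] {Q : CycleQuiver V} {M : CoxeterMatrix B}
    {σ : V → B} (h : Q.IsCoxeterTree M σ) {G : Type*} [Group G] (x : B → G) :
    Q.Holds (fun i => x (σ i)) ↔ ∀ r ∈ artinRelators M, FreeGroup.lift x r = 1 := by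
  obtain ⟨hcyc, hσ, hM⟩ := h
  constructor
  · rintro h r ⟨i, j, rfl⟩
    obtain ⟨i, rfl⟩ := hσ.2 i
    obtain ⟨j, rfl⟩ := hσ.2 j
    rw [hM, map_mul, map_inv, mul_inv_eq_one]
    split_ifs with h1 h2
    · simp [h1]
    · simpa [CoxeterSystem.alternatingWord, mul_assoc, Braided] using (h.braid i j h2).symm
    · simpa [CoxeterSystem.alternatingWord] using (h.comm i j h2).eq
  · intro h
    refine ⟨fun i j hij => ?_, fun i j hij => ?_, by simp [hcyc]⟩
    · have := h _ ⟨σ i, σ j, rfl⟩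
      rw [hM, if_neg hij.ne, if_pos hij, map_mul, map_inv, mul_inv_eq_one] at this
      simpa [CoxeterSystem.alternatingWord, mul_assoc, Braided] using this.symm
    · by_cases hij' : i = j
      · rw [hij']
      · have := h _ ⟨σ i, σ j, rfl⟩
        rw [hM, if_neg hij', if_neg hij, map_mul, map_inv, mul_inv_eq_one] at this
        simpa [CoxeterSystem.alternatingWord, commute_iff_eq] using this

theorem IsCoxeterTree.nonempty_mulEquiv [DecidableEq V] {Q : CycleQuiver V} {M : CoxeterMatrix B}
    {σ : V → B} (h : Q.IsCoxeterTree M σ) :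
    Nonempty (ArtinGroup M ≃* PresentedGroup Q.relators) := by
  let e := Equiv.ofBijective σ h.2.1
  have hσ : ∀ i, e.symm (σ i) = i := e.symm_apply_apply
  have hσ' : ∀ b, σ (e.symm b) = b := e.apply_symm_apply
  refine nonempty_mulEquiv_of_generators (x := fun b => PresentedGroup.of (e.symm b))
    (y := fun i => PresentedGroup.of (σ i)) ?_ ?_ (fun i => ?_)
    (fun b => ?_)
  · rw [← h.holds_iff]
    simpa only [hσ] using Q.holds_of
  · rw [← CycleQuiver.holds_iff, h.holds_iff]
    exact fun r hr => lift_of_eq_one hr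
  · rw [PresentedGroup.toGroup.of, hσ]
  · rw [PresentedGroup.toGroup.of, hσ']

end Artin

end CycleQuiver

/-! ### The Carter diagrams -/

/-- A vertex with three neighbours, any two of which lie in a common 4-cycle through it, excludes an
orientation: of any two of the three edges at the vertex, one would be ingoing and one outgoing. -/
theorem IsCycleOrientation.false_of_three_cycles {V : Type*} {Γ : SimpleGraph V} {D : Digraph V}
    (hD : IsCycleOrientation Γ D) (v a b c x y z : V) (hab : IsFourCycle Γ ![a, v, b, x])
    (hac : IsFourCycle Γ ![a, v, c, y]) (hbc : IsFourCycle Γ ![b, v, c, z]) : False := by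
  have key : ∀ p q w, IsFourCycle Γ ![p, v, q, w] → (D.Adj v q ↔ D.Adj p v) := by
    intro p q w h
    rcases hD.oriented _ h with h | h
    · exact iff_of_true (h 1) (h 0)
    · exact iff_of_false (hD.asymm _ _ (h 1)) (hD.asymm _ _ (h 0))
  have h1 := key a b x hab
  have h2 := key a c y hac
  have h3 := key b c z hbc
  have h4 : D.Adj b v ∨ D.Adj v b := (hD.adj_iff _ _).1 (hbc.2 0)
  have h5 := hD.asymm v b
  tauto

instance (t : EType) : NeZero t.rank := ⟨by cases t <;> decide⟩

instance {t : EType} (Δ : CarterDiagram t) : DecidableRel Δ.graph.Adj :=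
  fun i j => decidable_of_iff
    (i ≠ j ∧ ((i.val, j.val) ∈ Δ.edges ∨ (j.val, i.val) ∈ Δ.edges)) Iff.rfl

instance {t : EType} (Δ : CarterDiagram t) (c : Fin 4 → Fin t.rank) :
    Decidable (IsFourCycle Δ.graph c) := by
  unfold IsFourCycle
  infer_instance

/-- A quiver `Q` on the diagram, with the 4-cycles of the diagram, proves the presentation if its
mutation along `ks` is a Coxeter tree of type `E_n`, whose vertex `i` has the label `p[i]`. -/
theorem nonempty_mulEquiv_of_mutations {t : EType} {Δ : CarterDiagram t} {D : Digraph (Fin t.rank)}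
    (hD : IsCycleOrientation Δ.graph D) {C : Set (Fin 4 → Fin t.rank)}
    (hC : IsCycleTransversal D C) (Q : CycleQuiver (Fin t.rank)) (ks p : List (Fin t.rank))
    (h : (∀ i j, Q.graph.Adj i j ↔ Δ.graph.Adj i j) ∧ Q.ListsFourCycles ∧ Q.IsMutable ks ∧
      (Q.mutateList ks).IsCoxeterTree t.coxeterMatrix fun i => p.getD i 0) :
    Nonempty (ArtinGroup t.coxeterMatrix ≃* DiagramGroup Δ.graph C) := by
  obtain ⟨h1, h2, h3, h4⟩ := h
  obtain ⟨φ⟩ := CycleQuiver.nonempty_mulEquiv_diagramGroup (by ext; exact h1 _ _) hD hC h2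
  obtain ⟨ψ⟩ := h3.nonempty_mulEquiv
  obtain ⟨θ⟩ := h4.nonempty_mulEquiv
  exact ⟨θ.trans (ψ.symm.trans φ)⟩

end CarterArtin

theorem mainTheorem4 (t : CarterArtin.EType) (Δ : CarterArtin.CarterDiagram t)
    (D : Digraph (Fin t.rank)) (hD : CarterArtin.IsCycleOrientation Δ.graph D)
    (C : Set (Fin 4 → Fin t.rank)) (hC : CarterArtin.IsCycleTransversal D C) :
    Nonempty (CarterArtin.ArtinGroup t.coxeterMatrix ≃* CarterArtin.DiagramGroup Δ.graph C) := by
  -- The edges outside the 4-cycles carry no cycle relation, so their direction is free; it is chosen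
  -- such that a short sequence of mutations leads to a tree.
  open CarterArtin in
  cases Δ with
  | E6a1 =>
    exact nonempty_mulEquiv_of_mutations hD hC
      ⟨[(0, 1), (2, 1), (4, 3), (5, 4), (3, 0), (1, 4)],
        [[0, 1, 4, 3]]⟩
      [0, 3] [1, 2, 0, 3, 4, 5] (by decide +kernel)
  | E6a2 =>
    exact nonempty_mulEquiv_of_mutations hD hC
      ⟨[(0, 1), (2, 1), (4, 3), (4, 5), (3, 0), (1, 4), (5, 2)],
        [[1, 4, 5, 2], [0, 1, 4, 3]]⟩
      [1, 4, 0, 2] [2, 1, 4, 5, 3, 0] (by decide +kernel)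
  | E7a1 =>
    exact nonempty_mulEquiv_of_mutations hD hC
      ⟨[(0, 1), (2, 1), (4, 3), (5, 4), (3, 0), (1, 4), (6, 5)],
        [[0, 1, 4, 3]]⟩
      [0, 3] [1, 2, 0, 3, 4, 5, 6] (by decide +kernel)
  | E7a2 =>
    exact nonempty_mulEquiv_of_mutations hD hC
      ⟨[(0, 1), (2, 1), (4, 3), (5, 4), (3, 0), (1, 4), (6, 3)],
        [[0, 1, 4, 3]]⟩
      [0, 1, 2] [1, 4, 3, 5, 2, 0, 6] (by decide +kernel)
  | E7a3 =>
    exact nonempty_mulEquiv_of_mutations hD hC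
      ⟨[(0, 1), (2, 1), (4, 3), (4, 5), (3, 0), (1, 4), (5, 2), (6, 5)],
        [[1, 4, 5, 2], [0, 1, 4, 3]]⟩
      [1, 4, 0, 2] [4, 1, 2, 0, 3, 5, 6] (by decide +kernel)
  | E8a1 =>
    exact nonempty_mulEquiv_of_mutations hD hC
      ⟨[(0, 1), (2, 1), (4, 3), (5, 4), (3, 0), (1, 4), (6, 5), (7, 6)],
        [[0, 1, 4, 3]]⟩
      [0, 3] [1, 2, 0, 3, 4, 5, 6, 7] (by decide +kernel)
  | E8a2 =>
    exact nonempty_mulEquiv_of_mutations hD hC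
      ⟨[(0, 1), (2, 1), (4, 3), (5, 4), (3, 0), (1, 4), (6, 5), (7, 0)],
        [[0, 1, 4, 3]]⟩
      [3, 0, 7] [4, 2, 0, 1, 5, 6, 7, 3] (by decide +kernel)
  | E8a3 =>
    exact nonempty_mulEquiv_of_mutations hD hC
      ⟨[(0, 1), (2, 1), (4, 3), (5, 4), (3, 0), (1, 4), (6, 3), (7, 0)],
        [[0, 1, 4, 3]]⟩
      [0, 1, 2, 7, 4, 5] [0, 5, 2, 6, 4, 3, 7, 1] (by decide +kernel)
  | E8a4 =>
    exact nonempty_mulEquiv_of_mutations hD hC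
      ⟨[(0, 1), (2, 1), (4, 3), (4, 5), (3, 0), (1, 4), (5, 2), (6, 5), (7, 6)],
        [[1, 4, 5, 2], [0, 1, 4, 3]]⟩
      [1, 4, 0, 2] [4, 1, 2, 0, 3, 5, 6, 7] (by decide +kernel)
  | E8a5 =>
    exact nonempty_mulEquiv_of_mutations hD hC
      ⟨[(0, 1), (2, 1), (4, 3), (4, 5), (3, 0), (1, 4), (5, 2), (6, 5), (7, 0)],
        [[1, 4, 5, 2], [0, 1, 4, 3]]⟩
      [1, 4, 0, 2, 7] [4, 1, 2, 0, 3, 6, 7, 5] (by decide +kernel)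
  | E8a6 =>
    exact nonempty_mulEquiv_of_mutations hD hC
      ⟨[(0, 1), (2, 1), (4, 3), (4, 5), (3, 0), (1, 4), (5, 2), (6, 5), (7, 6), (2, 7)],
        [[1, 4, 5, 2], [0, 1, 4, 3], [5, 2, 7, 6]]⟩
      [0, 1, 2, 0, 7, 5, 6] [1, 6, 2, 7, 0, 3, 5, 4] (by decide +kernel)
  | E7a4 =>
    exact (hD.false_of_three_cycles 4 1 3 5 0 2 6 (by decide +kernel) (by decide +kernel)
      (by decide +kernel)).elim
  | E8a7 =>
    exact (hD.false_of_three_cycles 4 1 3 5 0 2 6 (by decide +kernel) (by decide +kernel)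
      (by decide +kernel)).elim
  | E8a8 =>
    exact (hD.false_of_three_cycles 0 1 2 4 3 5 6 (by decide +kernel) (by decide +kernel)
      (by decide +kernel)).elim
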